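/- There is (in ZFC) a topology $\tau$ on $\mathbb{R}$ that refines the Euclidean topology (in particular, $\tau$ is Hausdorff), belongs to the class $C(\omega_1)$, and has uncountable net weight. Moreover, $\tau$ can be taken of the following form: for each $r\in\mathbb{R}$ there is a sequence $a_r=(a_r(n))_{n\in\mathbb{N}}$ of pairwise distinct points of $\mathbb{R}\setminus\{r\}$ that converges to $r$ in the Euclidean topology, and the sets $$(q,s)\setminus\{a_r(n):n\in\mathbb{N}\},\qquad q,s\in\mathbb{Q},\ q<r<s,$$ form a neighbourhood base at $r$ in $\tau$. Here a topological space $X$ belongs to $C(\omega_1)$ if for every uncountable $D\subseteq X$ and every assignment of a neighbourhood $U(x)$ of $x$ to each $x\in D$ there is an uncountable $Y\subseteq D$ such that $y\in U(z)$ for all $y,z\in Y$. A network for $X$ is a family $\mathcal{N}$ of subsets of $X$ such that for every $x\in X$ and every neighbourhood $U$ of $x$ there is $N\in\mathcal{N}$ with $x\in N\subseteq U$; the net weight of $X$ is the smallest cardinality of a network for $X$. -/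

import Mathlib

open Set Filter Topology Cardinal

universe u

/-- A family `N` of subsets of a space `X` is a network if for every point `x` and every
neighbourhood `U` of `x` there is `S ∈ N` with `x ∈ S ⊆ U`. -/
def IsNetwork {X : Type u} [TopologicalSpace X] (N : Set (Set X)) : Prop :=
  ∀ x : X, ∀ U ∈ 𝓝 x, ∃ S ∈ N, x ∈ S ∧ S ⊆ U

/-- The net weight of `X`: the smallest cardinality of a network for `X`. -/
noncomputable def netWeight (X : Type u) [TopologicalSpace X] : Cardinal.{u} :=
  sInf {κ : Cardinal.{u} | ∃ N : Set (Set X), IsNetwork N ∧ #N = κ}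

/-- The family of all subsets is a network, so the infimum defining `netWeight` is attained. -/
theorem exists_isNetwork_card_eq_netWeight (X : Type u) [TopologicalSpace X] :
    ∃ N : Set (Set X), IsNetwork N ∧ #N = netWeight X := by
  have hne : {κ : Cardinal.{u} | ∃ N : Set (Set X), IsNetwork N ∧ #N = κ}.Nonempty :=
    ⟨_, Set.univ, fun _ U hU => ⟨U, mem_univ _, mem_of_mem_nhds hU, Subset.rfl⟩, rfl⟩
  exact csInf_mem hne

/-- The class `C(ω₁)`: for every partial neighbourhood assignment `U` with uncountable domain
`D ⊆ X` there is an uncountable `Y ⊆ D` with `y ∈ U z` for all `y, z ∈ Y`.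
Only the values of `U` on `D` matter. -/
def InCOmegaOne (X : Type u) [TopologicalSpace X] : Prop :=
  ∀ (D : Set X) (U : X → Set X), ¬ D.Countable → (∀ x ∈ D, U x ∈ 𝓝 x) →
    ∃ Y : Set X, Y ⊆ D ∧ ¬ Y.Countable ∧ ∀ y ∈ Y, ∀ z ∈ Y, y ∈ U z

/-- The usual topology of the real line. -/
abbrev euclideanTopology : TopologicalSpace ℝ := inferInstance

/-! Let every real `r` code a rank below ω₁ and a sequence of countable sets `Q r i`, so that every
such pair is coded. Choose `a r` with irrational terms of smaller rank, only finitely many below any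
`γ < rank r`, meeting every `Q r i` that accumulates at `r` with ranks cofinal in `rank r`. For
C(ω₁), fix one rational interval and discard the rationals; what remains is to find an uncountable
set free for `z ↦ range (a z)`. Either some rank occurs uncountably often, or points are selected at
non-limit positions among the ranks, where each has finitely many predecessors and greedy colouring
works. A countable network `N` is defeated by closing off: some rank `δ` and countable `Q i ⊆ N i`
accumulate at every point of `N i` of rank `δ`. If `r` codes `(δ, Q)`, each `N i` containing `r`
meets `range (a r)`, so none fits inside the neighbourhood `(range (a r))ᶜ`. -/

/-- There is an uncountable well-order with countable initial segments, of size at most the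
continuum. -/
theorem exists_omegaOne_order :
    ∃ (W : Type) (_ : LinearOrder W) (_ : WellFoundedLT W),
      (∀ γ : W, (Iio γ).Countable) ∧ Uncountable W ∧ #W ≤ 𝔠 := by
  refine ⟨(ℵ₁ : Cardinal.{0}).ord.ToType, inferInstance, inferInstance, fun γ => ?_, ?_, ?_⟩
  · rw [← Cardinal.le_aleph0_iff_set_countable, ← Order.lt_succ_iff, Cardinal.succ_aleph0]
    have h := Cardinal.mk_Iio_lt γ (by simp)
    rwa [Cardinal.mk_ord_toType] at h
  · rw [← Cardinal.aleph0_lt_mk_iff, Cardinal.mk_ord_toType]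
    exact Cardinal.aleph0_lt_aleph_one
  · rw [Cardinal.mk_ord_toType]
    exact Cardinal.aleph_one_le_continuum

/-- In an uncountable linear order with countable initial segments, countable sets are strictly
bounded above. -/
theorem exists_forall_lt_of_countable {W : Type*} [LinearOrder W] [Uncountable W]
    (hW : ∀ γ : W, (Iio γ).Countable) {S : Set W} (hS : S.Countable) :
    ∃ β, ∀ γ ∈ S, γ < β := by
  have hc : (⋃ γ ∈ S, Iic γ).Countable :=
    hS.biUnion fun γ _ => by
      rw [← Iio_insert]
      exact (hW γ).insert γ
  have hne : (⋃ γ ∈ S, Iic γ) ≠ Set.univ := by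
    intro h
    rw [h] at hc
    exact not_countable_univ hc
  obtain ⟨β, hβ⟩ := (ne_univ_iff_exists_notMem _).1 hne
  refine ⟨β, fun γ hγ => ?_⟩
  by_contra hlt
  exact hβ (mem_biUnion hγ (not_lt.1 hlt))

/-- A sequence that converges to a point without attaining it can be rearranged into an injective
sequence with the same range and the same limit. -/
theorem exists_injective_range_eq_tendsto {X : Type*} [TopologicalSpace X] [T1Space X] {r : X}
    {b : ℕ → X} (hb : Tendsto b atTop (𝓝 r)) (hne : ∀ n, b n ≠ r) :
    ∃ a : ℕ → X, Function.Injective a ∧ range a = range b ∧ Tendsto a atTop (𝓝 r) := by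
  have hinf : (range b).Infinite := by
    intro hfin
    have hU : (range b)ᶜ ∈ 𝓝 r :=
      hfin.isClosed.isOpen_compl.mem_nhds fun ⟨n, hn⟩ => hne n hn
    obtain ⟨n, hn⟩ := (hb.eventually hU).exists
    exact hn (mem_range_self n)
  have : Infinite (range b) := hinf.to_subtype
  have : Countable (range b) := (countable_range b).to_subtype
  obtain ⟨e⟩ : Nonempty (ℕ ≃ range b) := nonempty_equiv_of_countable
  have hinj : Function.Injective fun n => (e n : X) := Subtype.val_injective.comp e.injective
  refine ⟨fun n => e n, hinj, ?_, ?_⟩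
  · rw [show (fun n => (e n : X)) = Subtype.val ∘ e from rfl, range_comp, e.range_eq_univ,
      image_univ, Subtype.range_coe]
  · rw [← Nat.cofinite_eq_atTop]
    intro U hU
    have hfin : (b '' (b ⁻¹' U)ᶜ).Finite := by
      refine Finite.image _ ?_
      have := hb hU
      rwa [← Nat.cofinite_eq_atTop] at this
    refine (hfin.preimage hinj.injOn).subset ?_
    intro n hn
    obtain ⟨m, hm⟩ := (e n).2
    exact ⟨m, fun h => hn (by simpa [← hm] using h), hm⟩

/-! ### Sequences with ranks cofinal below their limit -/

/-- Given a rank function into a well-order with countable initial segments and a sequence of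
sets `Q r i` for each `r`, there are sequences `a r` converging to `r` whose irrational terms have
ranks cofinal in the rank of `r`, and which meet each `Q r i` that accumulates at `r` with ranks
cofinal in the rank of `r`. -/
theorem exists_convergent_sequences {W : Type*} [LinearOrder W] (hW : ∀ γ : W, (Iio γ).Countable)
    (rank : ℝ → W) (Q : ℝ → ℕ → Set ℝ) :
    ∃ a : ℝ → ℕ → ℝ,
      (∀ r, Function.Injective (a r) ∧ (∀ n, a r n ≠ r) ∧ Tendsto (a r) atTop (𝓝 r)) ∧
      (∀ r, ∀ x ∈ range (a r), Irrational x → rank x < rank r) ∧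
      (∀ r, ∀ γ < rank r, {x ∈ range (a r) | Irrational x ∧ rank x ≤ γ}.Finite) ∧
      (∀ r i, (∃ γ, γ < rank r) →
        (∀ γ < rank r, ∀ ε > 0, ∃ q ∈ Q r i, |q - r| < ε ∧ γ < rank q ∧ rank q < rank r) →
        (range (a r) ∩ Q r i).Nonempty) := by
  have hs : ∀ δ : W, ∃ s : ℕ → W, Iio δ ⊆ range s := fun δ => by
    have : Nonempty W := ⟨δ⟩
    exact (countable_iff_exists_subset_range.1 (hW δ))
  choose s hs using hs
  -- Stage `n` handles `Q r n` alone and exceeds the smaller ranks among the first `n + 1`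
  -- enumerated.
  let P : ℝ → ℕ → ℝ → Prop := fun r n q =>
    q ∈ Q r n ∧ rank q < rank r ∧ |q - r| < 1 / ((n : ℝ) + 1) ∧
      ∀ i ≤ n, s (rank r) i < rank r → s (rank r) i < rank q
  have hb : ∀ (r : ℝ) (n : ℕ), ∃ x : ℝ, x ≠ r ∧ |x - r| < 1 / ((n : ℝ) + 1) ∧
      (Irrational x → P r n x) ∧ ((∃ q, P r n q) → P r n x) := by
    intro r n
    by_cases h : ∃ q, P r n q
    · obtain ⟨q, hq⟩ := h
      exact ⟨q, fun h => (h ▸ hq.2.1).false, hq.2.2.1, fun _ => hq, fun _ => hq⟩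
    -- A rational filler is exempt from the rank conditions.
    · have hpos : (0 : ℝ) < 1 / ((n : ℝ) + 1) := by positivity
      obtain ⟨p, hp1, hp2⟩ := exists_rat_btwn (show r < r + 1 / ((n : ℝ) + 1) by linarith)
      refine ⟨p, hp1.ne', ?_, fun hirr => (hirr ⟨p, rfl⟩).elim, fun h' => (h h').elim⟩
      rw [abs_lt]
      constructor <;> linarith
  choose b hbne hbr hbi hbP using hb
  have htend : ∀ r, Tendsto (b r) atTop (𝓝 r) := by
    intro r
    rw [tendsto_iff_dist_tendsto_zero]
    refine squeeze_zero (fun _ => dist_nonneg) (fun n => ?_) tendsto_one_div_add_atTop_nhds_zero_nat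
    rw [Real.dist_eq]
    exact (hbr r n).le
  choose a hainj harange hatend using
    fun r => exists_injective_range_eq_tendsto (htend r) (hbne r)
  refine ⟨a, fun r => ⟨hainj r, fun n h => ?_, hatend r⟩, ?_, ?_, ?_⟩
  · obtain ⟨m, hm⟩ : a r n ∈ range (b r) := harange r ▸ mem_range_self n
    exact hbne r m (hm.trans h)
  · intro r x hx hirr
    rw [harange r] at hx
    obtain ⟨n, rfl⟩ := hx
    exact (hbi r n hirr).2.1
  · intro r γ hγ
    obtain ⟨i, rfl⟩ := hs _ hγ
    refine ((finite_Iio i).image (b r)).subset ?_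
    rintro x ⟨hx, hirr, hle⟩
    rw [harange r] at hx
    obtain ⟨n, rfl⟩ := hx
    refine ⟨n, ?_, rfl⟩
    by_contra hn
    exact (((hbi r n hirr).2.2.2 i (not_lt.1 hn) hγ).trans_le hle).false
  · rintro r i ⟨γ₀, hγ₀⟩ hgood
    have hγ : ∃ γ < rank r, ∀ j ≤ i, s (rank r) j < rank r → s (rank r) j ≤ γ := by
      have hfin : ({γ₀} ∪ s (rank r) '' {j | j ≤ i ∧ s (rank r) j < rank r}).Finite :=
        (finite_singleton _).union (((finite_Iic i).subset fun j hj => hj.1).image _)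
      obtain ⟨γ, hγmem, hγ⟩ := hfin.exists_maximal ⟨γ₀, Or.inl rfl⟩
      refine ⟨γ, ?_, fun j hj hlt => ?_⟩
      · rcases hγmem with h | ⟨j, hj, h⟩
        · exact (show γ = γ₀ from h) ▸ hγ₀
        · exact h ▸ hj.2
      · by_contra hcon
        exact hcon (hγ (Or.inr ⟨j, ⟨hj, hlt⟩, rfl⟩) (not_le.1 hcon).le)
    obtain ⟨γ, hγlt, hγ⟩ := hγ
    obtain ⟨q, hqQ, hqr, hγq, hqrank⟩ := hgood γ hγlt (1 / ((i : ℝ) + 1)) (by positivity)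
    have hP := hbP r i ⟨q, hqQ, hqrank, hqr, fun j hj hlt => (hγ j hj hlt).trans_lt hγq⟩
    exact ⟨b r i, harange r ▸ mem_range_self i, hP.1⟩

/-! ### Free sets -/

/-- A set mapping on an uncountable set, each point of which is mapped to finitely many points of
smaller rank, has an uncountable free subset. -/
theorem exists_uncountable_free_of_finite {X W : Type*} [LinearOrder W] [WellFoundedLT W]
    (rank : X → W) {D : Set X} (hD : ¬ D.Countable) (A : X → Set X)
    (hA : ∀ z ∈ D, ∀ y ∈ D ∩ A z, rank y < rank z) (hfin : ∀ z ∈ D, (D ∩ A z).Finite) :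
    ∃ Y ⊆ D, ¬ Y.Countable ∧ ∀ y ∈ Y, ∀ z ∈ Y, y ∉ A z := by
  have hwf : WellFounded fun x y : X => rank x < rank y := InvImage.wf rank wellFounded_lt
  -- Greedy colouring: the least colour not used on `D ∩ A z`.
  let step : ∀ z : X, (∀ y, rank y < rank z → ℕ) → ℕ := fun z c =>
    sInf {n | ∀ y (h : rank y < rank z), y ∈ D ∩ A z → c y h ≠ n}
  let c : X → ℕ := hwf.fix step
  have hc : ∀ z ∈ D, ∀ y ∈ D ∩ A z, c y ≠ c z := by
    intro z hz
    have heq : c z = sInf {n | ∀ y, rank y < rank z → y ∈ D ∩ A z → c y ≠ n} :=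
      hwf.fix_eq step z
    have hne : {n | ∀ y, rank y < rank z → y ∈ D ∩ A z → c y ≠ n}.Nonempty := by
      obtain ⟨n, hn⟩ := ((hfin z hz).image c).exists_notMem
      exact ⟨n, fun y _ hy h => hn ⟨y, hy, h⟩⟩
    intro y hy
    have := Nat.sInf_mem hne y (hA z hz y hy) hy
    rwa [heq]
  have hex : ∃ n, ¬ (D ∩ c ⁻¹' {n}).Countable := by
    by_contra! h
    have hsub : D ⊆ ⋃ n, D ∩ c ⁻¹' {n} := fun x hx => mem_iUnion.2 ⟨c x, hx, rfl⟩
    exact hD ((countable_iUnion h).mono hsub)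
  obtain ⟨n, hn⟩ := hex
  exact ⟨_, inter_subset_left, hn, fun y hy z hz hyz =>
    hc z hz.1 y ⟨hy.1, hyz⟩ (hy.2.trans hz.2.symm)⟩

/-- A set mapping such that the points of `A z` have ranks of order type at most `ω` below the rank
of `z` has an uncountable free subset inside every uncountable set. -/
theorem exists_uncountable_free {X W : Type*} [LinearOrder W] [WellFoundedLT W] [Uncountable W]
    (hW : ∀ γ : W, (Iio γ).Countable) (rank : X → W) {D : Set X} (hD : ¬ D.Countable)
    (A : X → Set X) (hA : ∀ z ∈ D, ∀ y ∈ D ∩ A z, rank y < rank z)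
    (hfin : ∀ z ∈ D, ∀ γ < rank z, {y ∈ D ∩ A z | rank y ≤ γ}.Finite) :
    ∃ Y ⊆ D, ¬ Y.Countable ∧ ∀ y ∈ Y, ∀ z ∈ Y, y ∉ A z := by
  by_cases hL : (rank '' D).Countable
  · have hex : ∃ δ ∈ rank '' D, ¬ (D ∩ rank ⁻¹' {δ}).Countable := by
      by_contra! h
      have hsub : D ⊆ ⋃ δ ∈ rank '' D, D ∩ rank ⁻¹' {δ} := fun x hx =>
        mem_biUnion (mem_image_of_mem rank hx) ⟨hx, rfl⟩
      exact hD ((hL.biUnion h).mono hsub)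
    obtain ⟨δ, -, hδ⟩ := hex
    refine ⟨_, inter_subset_left, hδ, fun y hy z hz hyz => ?_⟩
    have := hA z hz.1 y ⟨hy.1, hyz⟩
    rw [show rank y = δ from hy.2, show rank z = δ from hz.2] at this
    exact this.false
  · set L := rank '' D with hLdef
    -- The non-limit positions of `L`; the least element of `L` above any bound `β` is one.
    let S : Set W := {δ ∈ L | ∃ γ < δ, ∀ ε ∈ L, ε < δ → ε ≤ γ}
    have hS : ¬ S.Countable := by
      intro hSc
      obtain ⟨β, hβ⟩ := exists_forall_lt_of_countable hW hSc
      have hne : (L ∩ Ioi β).Nonempty := by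
        by_contra h
        refine hL (((hW β).insert β).mono fun ε hε => ?_)
        rw [Iio_insert]
        by_contra hlt
        exact h ⟨ε, hε, not_le.1 hlt⟩
      obtain ⟨δ, ⟨hδL, hδ⟩, hmin⟩ := WellFounded.has_min (wellFounded_lt (α := W)) _ hne
      have hδS : δ ∈ S := ⟨hδL, β, hδ, fun ε hε hlt => by
        by_contra hcon
        exact hmin ε ⟨hε, not_le.1 hcon⟩ hlt⟩
      exact (hβ δ hδS).not_gt hδ
    have hpt : ∀ δ : S, ∃ x ∈ D, rank x = δ := fun δ => δ.2.1
    choose f hfD hf using hpt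
    have hrange : ¬ (range f).Countable := by
      intro h
      have hsub : S ⊆ rank '' range f := fun δ hδ => ⟨f ⟨δ, hδ⟩, mem_range_self _, hf _⟩
      exact hS ((h.image rank).mono hsub)
    have hsub : range f ⊆ D := range_subset_iff.2 hfD
    obtain ⟨Y, hYD, hY, hfree⟩ := exists_uncountable_free_of_finite rank hrange A
      (fun z hz y hy => hA z (hsub hz) y ⟨hsub hy.1, hy.2⟩) (by
        rintro _ ⟨δ, rfl⟩
        obtain ⟨γ, hγ, hgap⟩ := δ.2.2
        refine (hfin (f δ) (hfD δ) γ ((hf δ).symm ▸ hγ)).subset fun y hy => ?_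
        have hyD : y ∈ D := hsub hy.1
        refine ⟨⟨hyD, hy.2⟩, hgap _ (mem_image_of_mem rank hyD) ?_⟩
        exact hf δ ▸ hA _ (hfD δ) y ⟨hyD, hy.2⟩)
    exact ⟨Y, hYD.trans hsub, hY, hfree⟩

/-! ### Closing off and coding -/

/-- For countably many sets `N i` of reals there are a rank `δ` and countable sets `Q i ⊆ N i` which
accumulate, with ranks cofinal in `δ`, at all points of `N i` of rank `δ`. -/
theorem exists_rank_countable_accumulating {W : Type*} [LinearOrder W] [WellFoundedLT W]
    [Uncountable W] (hW : ∀ γ : W, (Iio γ).Countable) (rank : ℝ → W) (N : ℕ → Set ℝ) :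
    ∃ δ : W, (∃ γ, γ < δ) ∧ ∃ Q : ℕ → Set ℝ, (∀ i, (Q i).Countable ∧ Q i ⊆ N i) ∧
      ∀ r, rank r = δ → ∀ i, r ∈ N i → ∀ γ < δ, ∀ ε > 0,
        ∃ q ∈ Q i, |q - r| < ε ∧ γ < rank q ∧ rank q < δ := by
  let R : ℕ × ℚ × ℚ → W → ℝ → Prop := fun k γ q =>
    q ∈ N k.1 ∧ (k.2.1 : ℝ) < q ∧ q < k.2.2 ∧ γ < rank q
  have hg : ∀ k γ, ∃ q, (∃ q, R k γ q) → R k γ q := fun k γ => by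
    by_cases h : ∃ q, R k γ q
    · exact ⟨h.choose, fun _ => h.choose_spec⟩
    · exact ⟨0, fun h' => (h h').elim⟩
  choose g hg using hg
  -- `β k` bounds the ranks in box `k` whenever they are bounded.
  have hβ : ∀ k, ∃ β, (∃ γ, ¬ ∃ q, R k γ q) → ¬ ∃ q, R k β q := fun k => by
    by_cases h : ∃ γ, ¬ ∃ q, R k γ q
    · exact ⟨h.choose, fun _ => h.choose_spec⟩
    · exact ⟨rank 0, fun h' => (h h').elim⟩
  choose β hβ using hβ
  obtain ⟨δ₀, hδ₀⟩ := exists_forall_lt_of_countable hW (countable_range β)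
  have hnext : ∀ δ, ∃ δ', ∀ k, ∀ γ ≤ δ, rank (g k γ) < δ' := fun δ => by
    have hc : (⋃ k, (fun γ => rank (g k γ)) '' Iic δ).Countable :=
      countable_iUnion fun k => by
        rw [← Iio_insert]
        exact ((hW δ).insert δ).image _
    obtain ⟨δ', h⟩ := exists_forall_lt_of_countable hW hc
    exact ⟨δ', fun k γ hγ => h _ (mem_iUnion.2 ⟨k, γ, hγ, rfl⟩)⟩
  choose next hnext using hnext
  let d : ℕ → W := fun n => next^[n] δ₀
  have hne : {δ | ∀ n, d n < δ}.Nonempty := by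
    obtain ⟨δ, hδ⟩ := exists_forall_lt_of_countable hW (countable_range d)
    exact ⟨δ, fun n => hδ _ (mem_range_self n)⟩
  obtain ⟨δ, hδ, hmin⟩ := WellFounded.has_min (wellFounded_lt (α := W)) _ hne
  have hclosed : ∀ k, ∀ γ < δ, rank (g k γ) < δ := by
    intro k γ hγ
    have hex : ∃ n, γ ≤ d n := by
      by_contra! h
      exact hmin γ h hγ
    obtain ⟨n, hn⟩ := hex
    refine (hnext (d n) k γ hn).trans ?_
    have := hδ (n + 1)
    rwa [show d (n + 1) = next (d n) from Function.iterate_succ_apply' next n δ₀] at this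
  refine ⟨δ, ⟨_, hδ 0⟩, fun i => N i ∩ ⋃ k, g k '' Iio δ, fun i => ⟨?_, inter_subset_left⟩, ?_⟩
  · exact (countable_iUnion fun k => (hW δ).image _).mono inter_subset_right
  · intro r hr i hri γ hγ ε hε
    obtain ⟨p, hp1, hp2⟩ := exists_rat_btwn (show r - ε < r by linarith)
    obtain ⟨s, hs1, hs2⟩ := exists_rat_btwn (show r < r + ε by linarith)
    let k : ℕ × ℚ × ℚ := (i, p, s)
    -- The point `r` lies in box `k` with rank above `β k`, so the ranks there are unbounded.
    have hR : ∃ q, R k γ q := by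
      by_contra h
      refine hβ k ⟨γ, h⟩ ⟨r, hri, hp2, hs1, ?_⟩
      rw [hr]
      exact (hδ₀ _ (mem_range_self k)).trans (hδ 0)
    obtain ⟨hN, h1, h2, h3⟩ := hg k γ hR
    refine ⟨g k γ, ⟨hN, mem_iUnion.2 ⟨k, γ, hγ, rfl⟩⟩, ?_, h3, hclosed k γ hγ⟩
    have h1' : (p : ℝ) < g k γ := h1
    have h2' : g k γ < (s : ℝ) := h2
    rw [abs_lt]
    constructor <;> linarith

/-- The reals carry a rank function and sequences of countable sets such that every pair of a rank
and a sequence of countable sets is attained. -/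
theorem exists_rank_and_sets {W : Type} (hW : #W ≤ 𝔠) [Nonempty W] :
    ∃ (rank : ℝ → W) (Q : ℝ → ℕ → Set ℝ), ∀ (δ : W) (S : ℕ → Set ℝ),
      (∀ i, (S i).Countable) → ∃ r, rank r = δ ∧ ∀ i, (S i).Nonempty → Q r i = S i := by
  have hcard : #(W × (ℕ → ℕ → ℝ)) ≤ #ℝ := by
    rw [Cardinal.mk_real]
    calc #(W × (ℕ → ℕ → ℝ)) = #W * 𝔠 := by simp [Cardinal.mk_real]
      _ ≤ 𝔠 * 𝔠 := mul_le_mul_left hW _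
      _ = 𝔠 := Cardinal.continuum_mul_self
  obtain ⟨e⟩ := hcard
  have hsurj := Function.invFun_surjective e.injective
  -- Sets are coded as ranges of sequences, hence the restriction to nonempty ones.
  refine ⟨fun r => (Function.invFun e r).1, fun r i => range ((Function.invFun e r).2 i), ?_⟩
  intro δ S hS
  have hq : ∀ i, ∃ q : ℕ → ℝ, (S i).Nonempty → S i = range q := fun i => by
    by_cases h : (S i).Nonempty
    · obtain ⟨q, hq⟩ := (hS i).exists_eq_range h
      exact ⟨q, fun _ => hq⟩
    · exact ⟨0, fun h' => (h h').elim⟩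
  choose q hq using hq
  obtain ⟨r, hr⟩ := hsurj (δ, q)
  exact ⟨r, by simp [hr], fun i hi => by simp [hr, hq i hi]⟩

/-! ### The topology and the theorem -/

/-- Removing from each rational interval around `r` the range of a sequence converging to `r`
defines neighbourhood bases of a topology finer than the usual one. -/
theorem exists_topology_of_sequences (a : ℝ → ℕ → ℝ) (hne : ∀ r n, a r n ≠ r)
    (ha : ∀ r, Tendsto (a r) atTop (𝓝 r)) :
    ∃ τ : TopologicalSpace ℝ,
      (∀ r : ℝ, (@nhds ℝ τ r).HasBasis
        (fun p : ℚ × ℚ => (p.1 : ℝ) < r ∧ r < (p.2 : ℝ))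
        (fun p : ℚ × ℚ => Ioo (p.1 : ℝ) (p.2 : ℝ) \ range (a r))) ∧
      τ ≤ euclideanTopology := by
  have hQ : ∀ r : ℝ, (𝓝 r).HasBasis (fun p : ℚ × ℚ => (p.1 : ℝ) < r ∧ r < (p.2 : ℝ))
      (fun p : ℚ × ℚ => Ioo (p.1 : ℝ) (p.2 : ℝ)) := by
    intro r
    refine ⟨fun U => ⟨fun hU => ?_, fun ⟨p, hp, hpU⟩ =>
      mem_of_superset (Ioo_mem_nhds hp.1 hp.2) hpU⟩⟩
    obtain ⟨l, u, ⟨hl, hu⟩, hsub⟩ := mem_nhds_iff_exists_Ioo_subset.1 hU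
    obtain ⟨p, hp1, hp2⟩ := exists_rat_btwn hl
    obtain ⟨q, hq1, hq2⟩ := exists_rat_btwn hu
    exact ⟨(p, q), ⟨hp2, hq1⟩, (Ioo_subset_Ioo hp1.le hq2.le).trans hsub⟩
  let n : ℝ → Filter ℝ := fun r => 𝓝 r ⊓ 𝓟 (range (a r))ᶜ
  have hb : ∀ r, (n r).HasBasis (fun p : ℚ × ℚ => (p.1 : ℝ) < r ∧ r < (p.2 : ℝ))
      (fun p : ℚ × ℚ => Ioo (p.1 : ℝ) (p.2 : ℝ) \ range (a r)) := fun r =>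
    (hQ r).inf_principal _
  suffices h : ∀ r, @nhds ℝ (.mkOfNhds n) r = n r by
    refine ⟨.mkOfNhds n, fun r => ?_, le_of_nhds_le_nhds fun r => ?_⟩
    · rw [h]
      exact hb r
    · rw [h]
      exact inf_le_left
  refine TopologicalSpace.nhds_mkOfNhds_of_hasBasis hb ?_ ?_
  · rintro r p hp
    exact ⟨hp, fun ⟨m, hm⟩ => hne r m hm⟩
  · intro r p hp
    filter_upwards [(hb r).mem_of_mem hp] with x hx
    -- Hence a basic set at `r` is a Euclidean neighbourhood of each of its points other than `r`.
    have hclosed : IsClosed (insert r (range (a r))) := (ha r).isCompact_insert_range.isClosed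
    by_cases hxr : x = r
    · subst hxr
      exact (hb x).mem_of_mem hp
    · have hU : (insert r (range (a r)))ᶜ ∈ 𝓝 x :=
        hclosed.isOpen_compl.mem_nhds fun h => h.elim hxr hx.2
      refine mem_inf_of_left ?_
      filter_upwards [hU, Ioo_mem_nhds hx.1.1 hx.1.2] with y hy hy'
      exact ⟨hy', fun h => hy (Or.inr h)⟩

theorem mainTheorem1 :
    ∃ a : ℝ → ℕ → ℝ,
      (∀ r : ℝ, Function.Injective (a r) ∧ (∀ n : ℕ, a r n ≠ r) ∧
        Tendsto (a r) atTop (@nhds ℝ euclideanTopology r)) ∧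
      ∃ τ : TopologicalSpace ℝ,
        (∀ r : ℝ, (@nhds ℝ τ r).HasBasis
          (fun p : ℚ × ℚ => (p.1 : ℝ) < r ∧ r < (p.2 : ℝ))
          (fun p : ℚ × ℚ => Set.Ioo (p.1 : ℝ) (p.2 : ℝ) \ Set.range (a r))) ∧
        (∀ V : Set ℝ, @IsOpen ℝ euclideanTopology V → @IsOpen ℝ τ V) ∧
        @T2Space ℝ τ ∧
        @InCOmegaOne ℝ τ ∧
        ℵ₀ < @netWeight ℝ τ := by
  have hT2 : @T2Space ℝ euclideanTopology := inferInstance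
  obtain ⟨W, _, _, hW, _, hcard⟩ := exists_omegaOne_order
  obtain ⟨rank, Q, hrQ⟩ := exists_rank_and_sets hcard
  obtain ⟨a, ha, harank, hafin, hahit⟩ := exists_convergent_sequences hW rank Q
  obtain ⟨τ, hτ, hle⟩ := exists_topology_of_sequences a (fun r => (ha r).2.1) fun r => (ha r).2.2
  refine ⟨a, ha, τ, hτ, hle, t2Space_antitone hle hT2, ?_, ?_⟩
  · intro D U hD hU
    have hp : ∀ x, ∃ p : ℚ × ℚ, x ∈ D →
        ((p.1 : ℝ) < x ∧ x < p.2) ∧ Ioo (p.1 : ℝ) p.2 \ range (a x) ⊆ U x := fun x => by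
      by_cases hx : x ∈ D
      · obtain ⟨p, hp⟩ := (hτ x).mem_iff.1 (hU x hx)
        exact ⟨p, fun _ => hp⟩
      · exact ⟨0, fun h => (hx h).elim⟩
    choose p hp using hp
    have hex : ∃ k, ¬ ({x ∈ D | p x = k} \ range ((↑) : ℚ → ℝ)).Countable := by
      by_contra! h
      refine hD (((countable_iUnion h).union (countable_range ((↑) : ℚ → ℝ))).mono fun x hx => ?_)
      by_cases hxq : x ∈ range ((↑) : ℚ → ℝ)
      · exact Or.inr hxq
      · exact Or.inl (mem_iUnion.2 ⟨p x, ⟨hx, rfl⟩, hxq⟩)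
    obtain ⟨k, hk⟩ := hex
    obtain ⟨Y, hYD, hY, hfree⟩ := exists_uncountable_free hW rank hk (fun z => range (a z))
      (fun z _ y hy => harank z y hy.2 hy.1.2)
      (fun z _ γ hγ => (hafin z γ hγ).subset fun y hy => ⟨hy.1.2, hy.1.1.2, hy.2⟩)
    refine ⟨Y, fun y hy => (hYD hy).1.1, hY, fun y hy z hz => ?_⟩
    have hz' := hp z (hYD hz).1.1
    have hy' := hp y (hYD hy).1.1
    rw [(hYD hz).1.2] at hz'
    rw [(hYD hy).1.2] at hy'
    exact hz'.2 ⟨hy'.1, hfree y hy z hz⟩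
  · by_contra! hnw
    obtain ⟨M, hM, hMcard⟩ := @exists_isNetwork_card_eq_netWeight ℝ τ
    have hMc : M.Countable := by
      rw [← Cardinal.le_aleph0_iff_set_countable, hMcard]
      exact hnw
    have hMne : M.Nonempty := by
      obtain ⟨S, hS, -⟩ := hM 0 univ univ_mem
      exact ⟨S, hS⟩
    obtain ⟨N, rfl⟩ := hMc.exists_eq_range hMne
    obtain ⟨δ, hδ, S, hS, hacc⟩ := exists_rank_countable_accumulating hW rank N
    obtain ⟨r, hr, hQr⟩ := hrQ δ S fun i => (hS i).1
    have hU : (range (a r))ᶜ ∈ @nhds ℝ τ r := by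
      obtain ⟨p, hp⟩ := exists_rat_lt r
      obtain ⟨q, hq⟩ := exists_rat_gt r
      exact (hτ r).mem_iff.2 ⟨(p, q), ⟨hp, hq⟩, fun x hx => hx.2⟩
    obtain ⟨_, ⟨i, rfl⟩, hri, hsub⟩ := hM r _ hU
    have hacc' := hacc r hr i hri
    obtain ⟨γ, hγ⟩ := hδ
    have hne : (S i).Nonempty := by
      obtain ⟨q, hq, -⟩ := hacc' γ hγ 1 one_pos
      exact ⟨q, hq⟩
    rw [← hr] at hacc' hγ
    rw [← hQr i hne] at hacc'
    obtain ⟨x, hxa, hxQ⟩ := hahit r i ⟨γ, hγ⟩ hacc'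
    rw [hQr i hne] at hxQ
    exact hsub ((hS i).2 hxQ) hxa
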